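/- Let $X$ be a separable real Fréchet space, let $d$ be a complete translation-invariant metric inducing its topology, and let $\mu$ be a centered Gaussian (Borel) measure on $X$. Let $X^*_\mu$ be the closure of $X^*$ in $L^2(\mu)$ and let $H$ be the Cameron–Martin space, i.e. the set of all $h\in X$ for which there is a (then unique) $g\in X^*_\mu$ with $f(h)=\int_X f g\,d\mu$ for all $f\in X^*$, equipped with the inner product $\langle h_1,h_2\rangle_H=\langle g_1,g_2\rangle_{L^2(\mu)}$. Let $B^H$ and $S^H$ be the open unit ball and the unit sphere of $H$, and let $B^d_r=\{x\in X: d(0,x)<r\}$, $B^d=B^d_1$. A *shape function* is a map $\phi:S^H\to \bigl(\mathrm{cl}_X(B^d)\cap H\bigr)\setminus B^H$ such that a) for every $x\in S^H$ there is $k(x)>0$ with $\phi(x)=k(x)\,x$, and $\phi(-x)=-\phi(x)$; b) there is a compact set $T\subset X$ such that for every open $U\supset T$ in $X$ there is a neighbourhood $V$ of $0$ in $X$ with $\phi(x)\in U$ for all $x\in S^H\cap V$; c) for every $\varepsilon>0$ the set $\phi(S^H\setminus B^d_\varepsilon)$ is bounded in the norm of $H$; d) $k(x)\to\infty$ as $x\to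 0$ in the topology of $X$, $x\in S^H$. Let $\phi$ be a shape function and let $K=\mathrm{cl}_X\,\mathrm{conv}\,\phi(S^H)$ be the closed convex hull in $X$ of its range. Then $K$ is symmetric, convex and compact in $X$. Moreover, the Minkowski functional $p_K(x)=\inf\{r>0: x\in rK\}$ is a norm on $\tilde E=\mathrm{span}(K)$, and $(\tilde E,p_K)$ is a Banach space. Let $E$ be the closed linear span of $H$ in $(\tilde E,p_K)$ (that is, the $p_K$-closure in $\tilde E$ of $H \cap \tilde E$), with the norm $p_K$. Then $E$ is a Banach space, $H\subset E\subset X$, and both inclusions $(H,\|\cdot\|_H)\hookrightarrow (E,p_K)\hookrightarrow X$ are compact linear operators. -/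

import Mathlib

open MeasureTheory ProbabilityTheory Filter Topology
open scoped Pointwise

noncomputable section

namespace Intermediate

section CameronMartin

variable {X : Type*} [TopologicalSpace X] [AddCommGroup X] [Module ℝ X]
  [MeasurableSpace X]

/-- The subspace of `L²(μ)` consisting of the classes of continuous linear functionals. -/
def dualL2 (μ : Measure X) : Submodule ℝ (Lp ℝ 2 μ) where
  carrier := {u | ∃ f : StrongDual ℝ X, u =ᵐ[μ] f}
  zero_mem' := ⟨0, by simpa using Lp.coeFn_zero ℝ 2 μ⟩
  add_mem' := by
    rintro u v ⟨f, hf⟩ ⟨g, hg⟩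
    refine ⟨f + g, ?_⟩
    filter_upwards [Lp.coeFn_add u v, hf, hg] with x h1 h2 h3
    rw [h1, Pi.add_apply, h2, h3, add_apply]
  smul_mem' := by
    rintro c u ⟨f, hf⟩
    refine ⟨c • f, ?_⟩
    filter_upwards [Lp.coeFn_smul c u, hf] with x h1 h2
    simp [h1, h2]

/-- The reproducing kernel Hilbert space `X*_μ`: the closure of `X*` in `L²(μ)`. -/
def rkhs (μ : Measure X) : Submodule ℝ (Lp ℝ 2 μ) := (dualL2 μ).topologicalClosure

/-- `h = R_μ(g)` for a centered measure `μ`: the functional `f ↦ ∫ f g dμ` on `X*` is evaluation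
at the point `h` of `X`. -/
def IsCovariance (μ : Measure X) (g : Lp ℝ 2 μ) (h : X) : Prop :=
  ∀ f : StrongDual ℝ X, f h = ∫ x, f x * g x ∂μ

theorem IsCovariance.smul {μ : Measure X} {g : Lp ℝ 2 μ} {h : X} (c : ℝ) (H : IsCovariance μ g h) :
    IsCovariance μ (c • g) (c • h) := by
  intro f
  rw [map_smul, H f, smul_eq_mul, ← integral_const_mul]
  refine integral_congr_ae ?_
  filter_upwards [Lp.coeFn_smul c g] with x hx
  rw [hx, Pi.smul_apply, smul_eq_mul]
  ring

variable [BorelSpace X] (μ : Measure X) [IsGaussian μ]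

theorem memLp_dual (f : StrongDual ℝ X) : MemLp f 2 μ := by
  suffices MemLp (id ∘ f) 2 μ from this
  rw [← memLp_map_measure_iff (by fun_prop) (by fun_prop), IsGaussian.map_eq_gaussianReal f]
  exact memLp_id_gaussianReal' 2 (by simp)

theorem integrable_dual_mul (f : StrongDual ℝ X) (g : Lp ℝ 2 μ) :
    Integrable (fun x => f x * g x) μ :=
  MemLp.integrable_mul (memLp_dual μ f) (Lp.memLp g)

variable {μ} in
theorem IsCovariance.add {g₁ g₂ : Lp ℝ 2 μ} {h₁ h₂ : X} (H₁ : IsCovariance μ g₁ h₁)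
    (H₂ : IsCovariance μ g₂ h₂) : IsCovariance μ (g₁ + g₂) (h₁ + h₂) := by
  intro f
  rw [map_add, H₁ f, H₂ f,
    ← integral_add (integrable_dual_mul μ f g₁) (integrable_dual_mul μ f g₂)]
  refine integral_congr_ae ?_
  filter_upwards [Lp.coeFn_add g₁ g₂] with x hx
  rw [hx, Pi.add_apply, mul_add]

/-- The Cameron–Martin space of `μ` as a linear subspace of `X`:
all `h = R_μ(g)` in `X` with `g ∈ X*_μ`. -/
def cameronMartin : Submodule ℝ X where
  carrier := {h | ∃ g ∈ rkhs μ, IsCovariance μ g h}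
  zero_mem' := by
    refine ⟨0, zero_mem _, fun f => ?_⟩
    have : (fun x => f x * (0 : Lp ℝ 2 μ) x) =ᵐ[μ] fun _ => 0 := by
      filter_upwards [Lp.coeFn_zero ℝ 2 μ] with x hx
      rw [hx, Pi.zero_apply, mul_zero]
    rw [integral_congr_ae this]
    simp
  add_mem' := by
    rintro a b ⟨g, hg, H⟩ ⟨g', hg', H'⟩
    exact ⟨g + g', add_mem hg hg', H.add H'⟩
  smul_mem' := by
    rintro c a ⟨g, hg, H⟩
    exact ⟨c • g, Submodule.smul_mem _ c hg, H.smul c⟩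

/-- The Cameron–Martin space `H` as a type of its own. It does not carry the topology of `X`; its
Hilbert space structure is defined below. -/
def CameronMartin : Type _ := ↥(cameronMartin μ)

instance : AddCommGroup (CameronMartin μ) := inferInstanceAs (AddCommGroup ↥(cameronMartin μ))
instance : Module ℝ (CameronMartin μ) := inferInstanceAs (Module ℝ ↥(cameronMartin μ))

/-- The inclusion of `H` into `X`. -/
def CameronMartin.incl : CameronMartin μ →ₗ[ℝ] X := (cameronMartin μ).subtype

variable {μ} in
theorem IsCovariance.unique {g₁ g₂ : Lp ℝ 2 μ} {h : X} (m₁ : g₁ ∈ rkhs μ) (m₂ : g₂ ∈ rkhs μ)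
    (H₁ : IsCovariance μ g₁ h) (H₂ : IsCovariance μ g₂ h) : g₁ = g₂ := by
  have H : IsCovariance μ (g₁ - g₂) 0 := by
    have := H₁.add (H₂.smul (-1))
    simpa [← sub_eq_add_neg] using this
  have hm : g₁ - g₂ ∈ (dualL2 μ).topologicalClosure := sub_mem m₁ m₂
  have ho : g₁ - g₂ ∈ (dualL2 μ)ᗮ := by
    rw [Submodule.mem_orthogonal]
    rintro u ⟨f, hf⟩
    rw [L2.inner_def, ← map_zero f, H f]
    refine integral_congr_ae ?_
    filter_upwards [hf] with x hx
    simp [hx, mul_comm]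
  rw [← Submodule.orthogonal_closure] at ho
  exact sub_eq_zero.1 <| (Submodule.mem_bot ℝ).1 <|
    (Submodule.inf_orthogonal_eq_bot (dualL2 μ).topologicalClosure) ▸ ⟨hm, ho⟩

/-- The linear map sending `h = R_μ(g)` in `H` to the unique such `g` in `X*_μ ⊆ L²(μ)`. -/
def CameronMartin.rep : CameronMartin μ →ₗ[ℝ] Lp ℝ 2 μ where
  toFun h := h.2.choose
  map_add' a b := IsCovariance.unique (a + b).2.choose_spec.1
    (add_mem a.2.choose_spec.1 b.2.choose_spec.1) (a + b).2.choose_spec.2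
    (a.2.choose_spec.2.add b.2.choose_spec.2)
  map_smul' c a := IsCovariance.unique (c • a).2.choose_spec.1
    (Submodule.smul_mem _ c a.2.choose_spec.1) (c • a).2.choose_spec.2
    (a.2.choose_spec.2.smul c)

theorem CameronMartin.rep_mem (h : CameronMartin μ) : CameronMartin.rep μ h ∈ rkhs μ :=
  h.2.choose_spec.1

theorem CameronMartin.rep_spec (h : CameronMartin μ) :
    IsCovariance μ (CameronMartin.rep μ h) (CameronMartin.incl μ h) :=
  h.2.choose_spec.2

variable [IsTopologicalAddGroup X] [ContinuousSMul ℝ X] [LocallyConvexSpace ℝ X] [T2Space X]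

theorem CameronMartin.rep_injective : Function.Injective (CameronMartin.rep μ) := by
  rw [injective_iff_map_eq_zero]
  intro h hh
  have hs := CameronMartin.rep_spec μ h
  rw [hh] at hs
  have h0 : CameronMartin.incl μ h = 0 := by
    refine SeparatingDual.eq_zero_of_forall_dual_eq_zero (R := ℝ) fun f => ?_
    rw [hs f]
    have : (fun x => f x * (0 : Lp ℝ 2 μ) x) =ᵐ[μ] fun _ => 0 := by
      filter_upwards [Lp.coeFn_zero ℝ 2 μ] with x hx
      rw [hx, Pi.zero_apply, mul_zero]
    rw [integral_congr_ae this]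
    simp
  exact Subtype.ext h0

/-- The norm `‖R_μ(g)‖_H = ‖g‖_{L²(μ)}`. -/
instance : NormedAddCommGroup (CameronMartin μ) :=
  NormedAddCommGroup.induced _ _ (CameronMartin.rep μ) (CameronMartin.rep_injective μ)

/-- The inner product `⟪R_μ(g₁), R_μ(g₂)⟫_H = ⟪g₁, g₂⟫_{L²(μ)}`. -/
instance : InnerProductSpace ℝ (CameronMartin μ) :=
  InnerProductSpace.induced (CameronMartin.rep μ)

/-- A locally convex space `E` with an injective linear map `j : E → X` (in practice an inclusion)
is an intermediate space if `H ⊆ E ⊆ X` with both inclusions compact linear maps. -/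
structure IsIntermediateSpace {E : Type*} [AddCommGroup E] [Module ℝ E] [TopologicalSpace E]
    (j : E →ₗ[ℝ] X) : Prop where
  injective : Function.Injective j
  compact_left : ∃ i : CameronMartin μ →ₗ[ℝ] E,
    (∀ h, j (i h) = CameronMartin.incl μ h) ∧ IsCompactOperator i
  compact_right : IsCompactOperator j

end CameronMartin

section Shape

variable {X : Type*} [MetricSpace X] [AddCommGroup X] [Module ℝ X]
  [IsTopologicalAddGroup X] [ContinuousSMul ℝ X] [LocallyConvexSpace ℝ X]
  [MeasurableSpace X] [BorelSpace X] (μ : Measure X) [IsGaussian μ]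

/-- A shape function `φ : S^H → cl_X(B^d) ∩ H \ B^H`; `factor` is `|φ|`. -/
structure ShapeFunction where
  toFun : Metric.sphere (0 : CameronMartin μ) 1 → CameronMartin μ
  mem_closure_ball : ∀ x, CameronMartin.incl μ (toFun x) ∈ closure (Metric.ball (0 : X) 1)
  notMem_ball : ∀ x, toFun x ∉ Metric.ball (0 : CameronMartin μ) 1
  /-- (a) -/
  factor : Metric.sphere (0 : CameronMartin μ) 1 → ℝ
  factor_pos : ∀ x, 0 < factor x
  eq_smul : ∀ x, toFun x = factor x • (x : CameronMartin μ)
  map_neg : ∀ x, toFun (-x) = -toFun x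
  /-- (b) -/
  near_compact : ∃ T : Set X, IsCompact T ∧ ∀ U : Set X, IsOpen U → T ⊆ U →
    ∃ V ∈ 𝓝 (0 : X), ∀ x : Metric.sphere (0 : CameronMartin μ) 1,
      CameronMartin.incl μ x ∈ V → CameronMartin.incl μ (toFun x) ∈ U
  /-- (c) -/
  bounded_away : ∀ ε > 0, Bornology.IsBounded
    (toFun '' {x | CameronMartin.incl μ x ∉ Metric.ball (0 : X) ε})
  /-- (d) -/
  tendsto_factor : Tendsto factor
    (comap (fun x : Metric.sphere (0 : CameronMartin μ) 1 => CameronMartin.incl μ x) (𝓝 0)) atTop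

/-- `K`, the closed convex hull in `X` of the range of the shape function. -/
def ShapeFunction.hull {μ : Measure X} [IsGaussian μ] (φ : ShapeFunction μ) : Set X :=
  closure (convexHull ℝ (Set.range fun x => CameronMartin.incl μ (φ.toFun x)))

end Shape

section Span

variable {X : Type*} [AddCommGroup X] [Module ℝ X]

/-- The linear span of `K`, without the topology of `X`. -/
def SpanOf (K : Set X) : Type _ := ↥(Submodule.span ℝ K)

instance (K : Set X) : AddCommGroup (SpanOf K) :=
  inferInstanceAs (AddCommGroup ↥(Submodule.span ℝ K))
instance (K : Set X) : Module ℝ (SpanOf K) :=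
  inferInstanceAs (Module ℝ ↥(Submodule.span ℝ K))

/-- The inclusion of the span of `K` into `X`. -/
def SpanOf.incl (K : Set X) : SpanOf K →ₗ[ℝ] X := (Submodule.span ℝ K).subtype

/-- The Minkowski functional `p_K` on the span of `K`. -/
instance (K : Set X) : Norm (SpanOf K) := ⟨fun x => gauge K (SpanOf.incl K x)⟩

end Span

section Generated

variable {X : Type*} [TopologicalSpace X] [AddCommGroup X] [Module ℝ X]
  [MeasurableSpace X] [BorelSpace X] (μ : Measure X) [IsGaussian μ]

/-- The closed linear span of `H` in the span of `K`, for a given vector topology on the latter. -/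
def generatedSpace (K : Set X) [TopologicalSpace (SpanOf K)] [ContinuousAdd (SpanOf K)]
    [ContinuousConstSMul ℝ (SpanOf K)] : Submodule ℝ (SpanOf K) :=
  (Submodule.span ℝ (SpanOf.incl K ⁻¹' (cameronMartin μ : Set X))).topologicalClosure

end Generated

end Intermediate

end

/-! Everything rests on the unit ball of `H` being precompact in `X`. By tightness some compact set
has measure at least `3 / 4`, and so does its closed absolutely convex hull `C`, again compact. A
functional bounded by 1 on `C` has a centered Gaussian law, hence a bounded variance, and
Cauchy–Schwarz in `L²(μ)` bounds it on the ball; Hahn–Banach then puts the ball inside `2 • C`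
(`CameronMartin.incl_mem_two_smul`).

The range of `φ` is then totally bounded: near 0 it is close to the compact set `T`, and away from 0
it is bounded in `H`. So `K` is compact, which makes `p_K` a complete norm and the inclusion into
`X` compact. For `H → E`, the bound `p_K(r x) ≤ r / k(x)` and `k(x) → ∞` make `p_K` small on those
bounded vectors of `H` that are small in `X`, so precompactness passes from `X` to `p_K`. -/

namespace Intermediate

/-! ### Precompactness of the Cameron–Martin ball -/

section CompactBall

open scoped NNReal ENNReal

/-- A centered Gaussian law with mass at least `3 / 4` on `[-1, 1]` has small variance. -/
theorem variance_le_of_gaussianReal_Icc {v : ℝ≥0}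
    (h : ENNReal.ofReal (3 / 4) ≤ gaussianReal 0 v (Set.Icc (-1) 1)) : (v : ℝ) ≤ 4 := by
  rcases eq_or_ne v 0 with rfl | hv
  · simp
  have hv0 : (0 : ℝ) < v := by exact_mod_cast pos_iff_ne_zero.2 hv
  set s := Real.sqrt (2 * Real.pi * v) with hs
  have hs0 : 0 < s := Real.sqrt_pos.2 (by positivity)
  -- The density never exceeds its value at the mean, so the mass of an interval of length 2 is at
  -- most `2 / s`.
  have hle : ∀ x, gaussianPDFReal 0 v x ≤ s⁻¹ := fun x => by
    rw [gaussianPDFReal]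
    refine mul_le_of_le_one_right (by positivity) (Real.exp_le_one_iff.2 ?_)
    rw [neg_div, neg_nonpos]
    positivity
  have hint : ∫ x in Set.Icc (-1 : ℝ) 1, gaussianPDFReal 0 v x ≤ 2 * s⁻¹ := by
    refine (setIntegral_mono (integrable_gaussianPDFReal 0 v).integrableOn
      (integrableOn_const (by simp)) hle).trans_eq ?_
    rw [setIntegral_const]
    norm_num
  have h34 : 3 / 4 ≤ 2 * s⁻¹ := by
    rw [gaussianReal_apply_eq_integral 0 hv] at h
    exact ((ENNReal.ofReal_le_ofReal_iff
      (setIntegral_nonneg measurableSet_Icc fun x _ => gaussianPDFReal_nonneg 0 v x)).1 h).trans hint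
  have h83 : s ≤ 8 / 3 := by
    rw [← div_eq_mul_inv, le_div_iff₀ hs0] at h34
    linarith
  have hsq : s ^ 2 = 2 * Real.pi * v := Real.sq_sqrt (by positivity)
  nlinarith [Real.pi_gt_three]

/-- Translation invariance identifies the metric uniformity with that of the additive group, so
completeness of the metric can be used in vector space arguments. -/
theorem isUniformAddGroup_of_dist_add_right {X : Type*} [PseudoMetricSpace X] [AddCommGroup X]
    (hdist : ∀ x y z : X, dist (x + z) (y + z) = dist x y) : IsUniformAddGroup X := by
  have hdist' : ∀ x y z : X, dist (z + x) (z + y) = dist x y := fun x y z => by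
    rw [add_comm z, add_comm z, hdist]
  have hsub : ∀ x y z : X, dist (z - x) (z - y) = dist x y := fun x y z => by
    rw [← hdist _ _ (x + y), dist_comm x y, ← hdist' y x z]
    congr 1 <;> abel
  refine ⟨Metric.uniformContinuous_iff.2 fun ε hε => ⟨ε / 2, half_pos hε, fun {a b} hab => ?_⟩⟩
  rw [Prod.dist_eq, max_lt_iff] at hab
  calc dist (a.1 - a.2) (b.1 - b.2)
      ≤ dist (a.1 - a.2) (b.1 - a.2) + dist (b.1 - a.2) (b.1 - b.2) := dist_triangle _ _ _
    _ = dist a.1 b.1 + dist a.2 b.2 := by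
        rw [hsub, sub_eq_add_neg, sub_eq_add_neg, hdist]
    _ < ε := by linarith [hab.1, hab.2]

section

variable {X : Type*} [TopologicalSpace X] [AddCommGroup X] [Module ℝ X]
  [MeasurableSpace X] [BorelSpace X] (μ : Measure X) [IsGaussian μ]

theorem integral_sq_le_of_abs_le_one (hcentered : ∀ f : StrongDual ℝ X, ∫ x, f x ∂μ = 0)
    {C : Set X} (hμC : ENNReal.ofReal (3 / 4) ≤ μ C) {f : StrongDual ℝ X}
    (hf : ∀ x ∈ C, |f x| ≤ 1) : ∫ x, f x * f x ∂μ ≤ 4 := by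
  have hlaw := IsGaussian.map_eq_gaussianReal (μ := μ) f
  rw [hcentered f] at hlaw
  have hvar : Var[f; μ] ≤ 4 := by
    rw [← Real.coe_toNNReal _ (variance_nonneg f μ)]
    refine variance_le_of_gaussianReal_Icc ?_
    rw [← hlaw, Measure.map_apply (by fun_prop) measurableSet_Icc]
    exact hμC.trans (measure_mono fun x hx => abs_le.1 (hf x hx))
  rw [variance_of_integral_eq_zero (by fun_prop) (hcentered f)] at hvar
  simpa [← pow_two] using hvar

variable [IsTopologicalAddGroup X] [ContinuousSMul ℝ X] [LocallyConvexSpace ℝ X] [T2Space X]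

theorem CameronMartin.norm_eq (h : CameronMartin μ) : ‖h‖ = ‖CameronMartin.rep μ h‖ := rfl

/-- Cauchy–Schwarz: `f h` is the `L²(μ)` inner product of `f` with the representative of `h`. -/
theorem CameronMartin.dual_apply_le (f : StrongDual ℝ X) (h : CameronMartin μ) :
    f (CameronMartin.incl μ h) ≤ Real.sqrt (∫ x, f x * f x ∂μ) * ‖h‖ := by
  set u : Lp ℝ 2 μ := (memLp_dual μ f).toLp f
  have hu : u =ᵐ[μ] f := (memLp_dual μ f).coeFn_toLp
  have h1 : f (CameronMartin.incl μ h) = inner ℝ u (CameronMartin.rep μ h) := by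
    rw [CameronMartin.rep_spec μ h f, L2.inner_def]
    refine integral_congr_ae ?_
    filter_upwards [hu] with x hx
    simp [hx, mul_comm]
  have h2 : ‖u‖ = Real.sqrt (∫ x, f x * f x ∂μ) := by
    rw [norm_eq_sqrt_real_inner, L2.inner_def]
    congr 1
    refine integral_congr_ae ?_
    filter_upwards [hu] with x hx
    simp [hx, pow_two]
  rw [h1, ← h2, CameronMartin.norm_eq]
  exact real_inner_le_norm _ _

/-- The unit ball of `H` is absorbed by every closed absolutely convex set of large measure. -/
theorem CameronMartin.incl_mem_two_smul (hcentered : ∀ f : StrongDual ℝ X, ∫ x, f x ∂μ = 0)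
    {C : Set X} (hC : AbsConvex ℝ C) (hcl : IsClosed C) (hμC : ENNReal.ofReal (3 / 4) ≤ μ C)
    {h : CameronMartin μ} (hh : ‖h‖ ≤ 1) : CameronMartin.incl μ h ∈ (2 : ℝ) • C := by
  by_contra hn
  obtain ⟨f, u, hfu, huf⟩ :=
    geometric_hahn_banach_closed_point (hC.2.smul 2) (hcl.smul_of_ne_zero two_ne_zero) hn
  have hne : C.Nonempty := by
    rw [Set.nonempty_iff_ne_empty]
    rintro rfl
    norm_num at hμC
  have hu : 0 < u := by
    simpa using hfu 0 ⟨0, hC.1.zero_mem hne, smul_zero _⟩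
  -- Separation gives `f < u` on `2 • C`; since `C` is symmetric, `|f| < u / 2` on `C`.
  have hfC : ∀ x ∈ C, |((2 / u) • f) x| ≤ 1 := by
    intro x hx
    have h1 := hfu _ (Set.smul_mem_smul_set hx)
    have h2 := hfu _ (Set.smul_mem_smul_set (hC.1.neg_mem_iff.2 hx))
    simp only [map_smul, map_neg, smul_eq_mul] at h1 h2
    rw [smul_apply, smul_eq_mul, abs_mul, abs_of_pos (by positivity), div_mul_eq_mul_div,
      div_le_one hu, ← abs_two, ← abs_mul]
    exact abs_le.2 ⟨by linarith, h1.le⟩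
  have h1 := CameronMartin.dual_apply_le μ ((2 / u) • f) h
  have h2 := Real.sqrt_le_sqrt (integral_sq_le_of_abs_le_one μ hcentered hμC hfC)
  rw [show (4 : ℝ) = 2 ^ 2 by norm_num, Real.sqrt_sq two_pos.le] at h2
  have h3 : ((2 / u) • f) (CameronMartin.incl μ h) ≤ 2 := by
    refine h1.trans ?_
    nlinarith [norm_nonneg h, Real.sqrt_nonneg (∫ x, ((2 / u) • f) x * ((2 / u) • f) x ∂μ)]
  rw [smul_apply, smul_eq_mul, div_mul_eq_mul_div, div_le_iff₀ hu] at h3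
  linarith

end

theorem CameronMartin.exists_isCompact_incl_mem {X : Type*} [UniformSpace X] [AddCommGroup X]
    [Module ℝ X] [IsUniformAddGroup X] [ContinuousSMul ℝ X] [LocallyConvexSpace ℝ X] [T2Space X]
    [CompleteSpace X] [PolishSpace X] [MeasurableSpace X] [BorelSpace X] (μ : Measure X)
    [IsGaussian μ] (hcentered : ∀ f : StrongDual ℝ X, ∫ x, f x ∂μ = 0) :
    ∃ C : Set X, IsCompact C ∧
      ∀ h : CameronMartin μ, ‖h‖ ≤ 1 → CameronMartin.incl μ h ∈ C := by
  obtain ⟨C₀, hC₀, hμ⟩ := isTightMeasureSet_iff_exists_isCompact_measure_compl_le.1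
    (isTightMeasureSet_singleton (μ := μ)) (ENNReal.ofReal (1 / 4)) (by simp)
  have hμC₀ : ENNReal.ofReal (3 / 4) ≤ μ C₀ := by
    have h1 := prob_add_prob_compl (μ := μ) hC₀.measurableSet
    have h2 := hμ μ rfl
    rw [show (3 / 4 : ℝ) = 1 - 1 / 4 by norm_num, ENNReal.ofReal_sub _ (by norm_num),
      ENNReal.ofReal_one, ← h1]
    exact tsub_le_iff_right.2 (by gcongr)
  have hC := isCompact_closedAbsConvexHull_of_totallyBounded hC₀.totallyBounded
  refine ⟨(2 : ℝ) • closedAbsConvexHull ℝ C₀, hC.smul 2, fun h hh =>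
    CameronMartin.incl_mem_two_smul μ hcentered absConvex_convexClosedHull
      isClosed_closedAbsConvexHull (hμC₀.trans (measure_mono subset_closedAbsConvexHull)) hh⟩

end CompactBall

/-! ### The Minkowski functional as a norm on the span -/

section Gauge

variable {X : Type*} [AddCommGroup X] [Module ℝ X] {K : Set X}

theorem zero_mem_of_convex_of_neg_eq (hconv : Convex ℝ K) (hneg : -K = K) (hne : K.Nonempty) :
    (0 : X) ∈ K := by
  obtain ⟨x, hx⟩ := hne
  have := hconv hx (hneg ▸ Set.neg_mem_neg.2 hx : -x ∈ K) one_half_pos.le one_half_pos.le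
    (add_halves 1)
  simpa using this

theorem SpanOf.incl_injective (K : Set X) : Function.Injective (SpanOf.incl K) :=
  Subtype.val_injective

theorem SpanOf.norm_def (x : SpanOf K) : ‖x‖ = gauge K (SpanOf.incl K x) := rfl

theorem SpanOf.norm_eq_gauge_preimage (x : SpanOf K) :
    ‖x‖ = gauge (SpanOf.incl K ⁻¹' K) x := by
  simp only [norm_def, gauge_def', Set.mem_preimage, map_smul]

theorem SpanOf.subsingleton_of_empty (x : SpanOf (∅ : Set X)) : x = 0 := by
  obtain ⟨x, hx⟩ := x
  exact Subtype.ext (by rw [Submodule.span_empty, Submodule.mem_bot] at hx; exact hx)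

/-- The dilates of `K` already fill a subspace: convexity gives `r • K + s • K = (r + s) • K`, and
symmetry handles negative scalars. -/
theorem exists_pos_mem_smul_of_mem_span (hconv : Convex ℝ K) (hneg : -K = K) (hne : K.Nonempty)
    {x : X} (hx : x ∈ Submodule.span ℝ K) : ∃ r : ℝ, 0 < r ∧ x ∈ r • K := by
  have h0 := zero_mem_of_convex_of_neg_eq hconv hneg hne
  induction hx using Submodule.span_induction with
  | mem x hx => exact ⟨1, one_pos, by simpa using hx⟩
  | zero => exact ⟨1, one_pos, by simpa using h0⟩
  | add x y _ _ hx hy =>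
    obtain ⟨r, hr, hx⟩ := hx
    obtain ⟨s, hs, hy⟩ := hy
    exact ⟨r + s, add_pos hr hs, by
      rw [hconv.add_smul hr.le hs.le]
      exact Set.add_mem_add hx hy⟩
  | smul c x _ hx =>
    obtain ⟨r, hr, y, hy, rfl⟩ := hx
    rcases lt_trichotomy c 0 with hc | rfl | hc
    · refine ⟨-c * r, by nlinarith, -y, hneg ▸ Set.neg_mem_neg.2 hy, by simp [mul_smul]⟩
    · exact ⟨1, one_pos, by simpa using h0⟩
    · exact ⟨c * r, by positivity, y, hy, mul_smul c r y⟩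


theorem SpanOf.balanced_preimage (hconv : Convex ℝ K) (hneg : -K = K) :
    Balanced ℝ (SpanOf.incl K ⁻¹' K) := by
  rw [balanced_iff_neg_mem (hconv.linear_preimage _)]
  · intro x hx
    rw [Set.mem_preimage, map_neg, ← Set.mem_neg, hneg]
    exact hx

theorem SpanOf.absorbent_preimage (hconv : Convex ℝ K) (hneg : -K = K) (hne : K.Nonempty) :
    Absorbent ℝ (SpanOf.incl K ⁻¹' K) := by
  refine absorbent_iff_inv_smul.2 fun x => ?_
  obtain ⟨r, hr, y, hy, hxy⟩ := exists_pos_mem_smul_of_mem_span hconv hneg hne x.2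
  let y' : SpanOf K := ⟨y, Submodule.subset_span hy⟩
  have hx : x = r • y' := Subtype.ext hxy.symm
  filter_upwards [tendsto_norm_cobounded_atTop.eventually_ge_atTop r] with c hc
  rw [hx, smul_smul]
  refine (SpanOf.balanced_preimage hconv hneg).smul_mem ?_ hy
  rw [norm_mul, norm_inv, Real.norm_of_nonneg hr.le, inv_mul_le_iff₀ (hr.trans_le hc), mul_one]
  exact hc

/-- If `H = 0`, its unit sphere is empty and so is `K`. Inserting 0 covers this case and changes
nothing for a nonempty symmetric convex `K`. -/
theorem SpanOf.norm_le_of_mem {x : SpanOf K} {r : ℝ} (hr : 0 ≤ r)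
    (hx : SpanOf.incl K x ∈ r • insert 0 K) : ‖x‖ ≤ r := by
  rw [norm_def]
  obtain ⟨y, rfl | hy, hxy⟩ := hx
  · simpa [← hxy] using hr
  · exact gauge_le_of_mem hr ⟨y, hy, hxy⟩

theorem SpanOf.mem_of_norm_lt (hconv : Convex ℝ K) (hneg : -K = K) {x : SpanOf K} {r : ℝ}
    (hx : ‖x‖ < r) : SpanOf.incl K x ∈ r • insert 0 K := by
  rcases K.eq_empty_or_nonempty with rfl | hne
  · rw [SpanOf.subsingleton_of_empty x, map_zero]
    exact ⟨0, Set.mem_insert _ _, smul_zero r⟩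
  have h0 := zero_mem_of_convex_of_neg_eq hconv hneg hne
  rw [norm_eq_gauge_preimage] at hx
  obtain ⟨s, hs, hsr, y, hy, rfl⟩ :=
    exists_lt_of_gauge_lt (SpanOf.absorbent_preimage hconv hneg hne) hx
  have hr : 0 < r := hs.trans hsr
  refine ⟨(s / r) • SpanOf.incl K y, Set.mem_insert_of_mem _ (hconv.smul_mem_of_zero_mem h0 hy
    ⟨by positivity, (div_le_one hr).2 hsr.le⟩), ?_⟩
  simp only [smul_smul, map_smul]
  rw [mul_div_cancel₀ _ hr.ne']

theorem SpanOf.normedSpaceCore [TopologicalSpace X] [T1Space X] (hconv : Convex ℝ K)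
    (hneg : -K = K) (hb : Bornology.IsVonNBounded ℝ K) : NormedSpace.Core ℝ (SpanOf K) where
  norm_nonneg x := gauge_nonneg _
  norm_smul c x := by
    rcases K.eq_empty_or_nonempty with rfl | hne
    · simp [norm_def]
    · rw [norm_eq_gauge_preimage, norm_eq_gauge_preimage,
        gauge_smul (SpanOf.balanced_preimage hconv hneg)]
  norm_triangle x y := by
    rcases K.eq_empty_or_nonempty with rfl | hne
    · simp [norm_def]
    · simp only [norm_eq_gauge_preimage]
      exact gauge_add_le (hconv.linear_preimage _) (SpanOf.absorbent_preimage hconv hneg hne) x y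
  norm_eq_zero_iff x := by
    refine ⟨fun hx => ?_, fun hx => by rw [hx, norm_def, map_zero, gauge_zero]⟩
    by_contra hne
    have hne' : SpanOf.incl K x ≠ 0 := fun h =>
      hne (SpanOf.incl_injective K (h.trans (map_zero _).symm))
    -- A nonzero vector of gauge 0 would lie in every positive dilate of `insert 0 K`; but a small
    -- dilate of the bounded set `K` avoids that vector.
    have hU : {SpanOf.incl K x}ᶜ ∈ 𝓝 (0 : X) := isOpen_compl_singleton.mem_nhds hne'.symm
    obtain ⟨r, hr, hKr⟩ := (hb hU).exists_pos
    obtain ⟨y, hy, hxy⟩ := SpanOf.mem_of_norm_lt hconv hneg (hx.trans_lt (inv_pos.2 hr))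
    rcases hy with rfl | hy
    · exact hne' (by simpa using hxy.symm)
    · obtain ⟨z, hz, hzy⟩ := hKr r (Real.norm_of_nonneg hr.le).ge hy
      apply hz
      rw [Set.mem_singleton_iff, ← hxy, ← hzy]
      exact (inv_smul_smul₀ hr.ne' z).symm

end Gauge

/-! ### Completeness and compactness criteria -/

section Disk

variable {X : Type*} [UniformSpace X] [AddCommGroup X] [Module ℝ X]
  {D : Set X}

theorem isCompactOperator_of_ball_mem {F : Type*} [SeminormedAddCommGroup F] [Module ℝ F]
    {j : F →ₗ[ℝ] X} (hD : IsCompact D) (h : ∀ x, ‖x‖ < 1 → j x ∈ D) : IsCompactOperator j :=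
  ⟨D, hD, mem_of_superset (Metric.ball_mem_nhds 0 one_pos) fun x hx =>
    h x (mem_ball_zero_iff.1 hx)⟩

variable [IsUniformAddGroup X]

/-- A normed space whose unit ball is a compact set of a complete space is complete. -/
theorem completeSpace_of_isCompact_disk [ContinuousSMul ℝ X] [T2Space X] [CompleteSpace X] {F : Type*}
    [NormedAddCommGroup F] [NormedSpace ℝ F] {j : F →ₗ[ℝ] X} (hD : IsCompact D)
    (hrange : D ⊆ Set.range j) (hlt : ∀ (x : F) (r : ℝ), ‖x‖ < r → j x ∈ r • D)
    (hle : ∀ (x : F) (r : ℝ), 0 ≤ r → j x ∈ r • D → ‖x‖ ≤ r) : CompleteSpace F := by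
  have hcpt : IsCompactOperator j :=
    isCompactOperator_of_ball_mem hD fun x hx => by simpa using hlt x 1 hx
  have huc : UniformContinuous j :=
    uniformContinuous_addMonoidHom_of_continuous hcpt.continuous
  refine Metric.complete_of_cauchySeq_tendsto fun u hu => ?_
  obtain ⟨x, hx⟩ := cauchySeq_tendsto_of_complete (huc.comp_cauchySeq hu)
  -- The dilates of `D` are closed in `X`, so the Cauchy estimate survives passing to the limit
  -- taken in `X`.
  have key : ∀ ε : ℝ, 0 < ε → ∃ N, ∀ n ≥ N, j (u n) - x ∈ ε • D := by
    intro ε hε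
    obtain ⟨N, hN⟩ := Metric.cauchySeq_iff.1 hu ε hε
    refine ⟨N, fun n hn => (hD.smul ε).isClosed.mem_of_tendsto (tendsto_const_nhds.sub hx) ?_⟩
    filter_upwards [eventually_ge_atTop N] with m hm
    have := hlt (u n - u m) ε (by simpa [dist_eq_norm] using hN n hn m hm)
    rwa [map_sub] at this
  obtain ⟨N, hN⟩ := key 1 one_pos
  obtain ⟨y, hy, hyx⟩ := hN N le_rfl
  obtain ⟨z, rfl⟩ := hrange hy
  have hjx : j (u N - z) = x := by
    rw [map_sub]
    simp only [one_smul] at hyx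
    rw [hyx]
    abel
  refine ⟨u N - z, Metric.tendsto_atTop.2 fun ε hε => ?_⟩
  obtain ⟨M, hM⟩ := key (ε / 2) (half_pos hε)
  refine ⟨M, fun n hn => ?_⟩
  rw [dist_eq_norm]
  refine (hle _ (ε / 2) (half_pos hε).le ?_).trans_lt (half_lt_self hε)
  rw [map_sub, hjx]
  exact hM n hn

/-- A linear map into a Banach space is compact if it is continuous on bounded sets for a
topology in which the unit ball is totally bounded. -/
theorem isCompactOperator_of_totallyBounded_image {H E : Type*} [SeminormedAddCommGroup H]
    [NormedSpace ℝ H] [NormedAddCommGroup E] [NormedSpace ℝ E] [CompleteSpace E]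
    {i : H →ₗ[ℝ] E} {ι : H →ₗ[ℝ] X} (htb : TotallyBounded (ι '' Metric.closedBall 0 1))
    (hcont : ∀ ε > 0, ∃ V ∈ 𝓝 (0 : X), ∀ y : H, ‖y‖ ≤ 2 → ι y ∈ V → ‖i y‖ < ε) :
    IsCompactOperator i := by
  have htb' : TotallyBounded (i '' Metric.closedBall 0 1) := by
    refine Metric.totallyBounded_iff.2 fun ε hε => ?_
    obtain ⟨V, hV, hVi⟩ := hcont ε hε
    have hent : {p : X × X | p.1 - p.2 ∈ V} ∈ uniformity X := by
      rw [uniformity_eq_comap_nhds_zero_swapped]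
      exact preimage_mem_comap hV
    obtain ⟨t, hts, htf, hcov⟩ := totallyBounded_iff_subset.1 htb _ hent
    have hts' : ∀ y ∈ t, ∃ h ∈ Metric.closedBall (0 : H) 1, ι h = y := fun y hy => hts hy
    choose! g hg hgt using hts'
    refine ⟨(fun y => i (g y)) '' t, htf.image _, ?_⟩
    rintro _ ⟨x, hx, rfl⟩
    obtain ⟨y, hy, hxy⟩ := Set.mem_iUnion₂.1 (hcov (Set.mem_image_of_mem ι hx))
    refine Set.mem_iUnion₂.2 ⟨_, Set.mem_image_of_mem _ hy, ?_⟩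
    -- A difference of two vectors of the unit ball has norm at most 2, hence the radius in `hcont`.
    rw [Metric.mem_ball, dist_eq_norm, ← map_sub]
    refine hVi _ ?_ ?_
    · have h1 := mem_closedBall_zero_iff.1 hx
      have h2 := mem_closedBall_zero_iff.1 (hg y hy)
      linarith [norm_sub_le x (g y)]
    · rw [map_sub, hgt y hy]
      exact hxy
  exact ⟨closure (i '' Metric.closedBall 0 1), htb'.closure.isCompact_of_isClosed isClosed_closure,
    mem_of_superset (Metric.closedBall_mem_nhds 0 one_pos) fun x hx =>
      subset_closure (Set.mem_image_of_mem i hx)⟩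

end Disk

theorem exists_sphere_smul {E : Type*} [NormedAddCommGroup E] [NormedSpace ℝ E] {y : E}
    (hy : y ≠ 0) : ∃ x : Metric.sphere (0 : E) 1, y = ‖y‖ • (x : E) := by
  have hy' : ‖y‖ ≠ 0 := norm_ne_zero_iff.2 hy
  refine ⟨⟨‖y‖⁻¹ • y, ?_⟩, (smul_inv_smul₀ hy' y).symm⟩
  rw [mem_sphere_zero_iff_norm, norm_smul, norm_inv, norm_norm, inv_mul_cancel₀ hy']

/-! ### Compactness of the hull and smallness of its gauge -/

section Shape

variable {X : Type*} [MetricSpace X] [AddCommGroup X] [Module ℝ X]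
  [IsTopologicalAddGroup X] [ContinuousSMul ℝ X] [LocallyConvexSpace ℝ X]
  [MeasurableSpace X] [BorelSpace X] {μ : Measure X} [IsGaussian μ] (φ : ShapeFunction μ)

namespace ShapeFunction

theorem incl_toFun (x : Metric.sphere (0 : CameronMartin μ) 1) :
    CameronMartin.incl μ (φ.toFun x) = φ.factor x • CameronMartin.incl μ x := by
  rw [φ.eq_smul, map_smul]

theorem one_le_factor (x : Metric.sphere (0 : CameronMartin μ) 1) : 1 ≤ φ.factor x := by
  have h := φ.notMem_ball x
  rw [mem_ball_zero_iff, not_lt, φ.eq_smul, norm_smul, Real.norm_of_nonneg (φ.factor_pos x).le,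
    mem_sphere_zero_iff_norm.1 x.2, mul_one] at h
  exact h

theorem incl_toFun_mem_hull (x : Metric.sphere (0 : CameronMartin μ) 1) :
    CameronMartin.incl μ (φ.toFun x) ∈ φ.hull :=
  subset_closure (subset_convexHull ℝ _ ⟨x, rfl⟩)

theorem convex_hull : Convex ℝ φ.hull := (convex_convexHull ℝ _).closure

theorem neg_hull : -φ.hull = φ.hull := by
  have hrange : -(Set.range fun x => CameronMartin.incl μ (φ.toFun x)) =
      Set.range fun x => CameronMartin.incl μ (φ.toFun x) := by
    ext y
    simp only [Set.mem_neg, Set.mem_range]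
    constructor <;> rintro ⟨x, hx⟩ <;>
      exact ⟨-x, by simp [φ.map_neg, hx]⟩
  rw [hull, neg_closure, ← convexHull_neg, hrange]

theorem incl_smul_mem (x : Metric.sphere (0 : CameronMartin μ) 1) (r : ℝ) :
    CameronMartin.incl μ (r • (x : CameronMartin μ)) ∈ (r / φ.factor x) • φ.hull := by
  refine ⟨_, φ.incl_toFun_mem_hull x, ?_⟩
  simp only [incl_toFun, smul_smul, map_smul]
  rw [div_mul_cancel₀ _ (φ.factor_pos x).ne']

theorem incl_mem_span (y : CameronMartin μ) :
    CameronMartin.incl μ y ∈ Submodule.span ℝ φ.hull := by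
  rcases eq_or_ne y 0 with rfl | hy
  · rw [map_zero]
    exact zero_mem _
  · obtain ⟨x, hx⟩ := exists_sphere_smul hy
    obtain ⟨z, hz, hzy⟩ := φ.incl_smul_mem x ‖y‖
    rw [hx, ← hzy]
    exact Submodule.smul_mem _ _ (Submodule.subset_span hz)

theorem gauge_incl_smul_le (x : Metric.sphere (0 : CameronMartin μ) 1) {r : ℝ} (hr : 0 ≤ r) :
    gauge φ.hull (CameronMartin.incl μ (r • (x : CameronMartin μ))) ≤ r / φ.factor x :=
  gauge_le_of_mem (div_nonneg hr (φ.factor_pos x).le) (φ.incl_smul_mem x r)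

/-- On bounded subsets of `H`, the functional `p_K` is continuous at `0` for the topology
of `X`. -/
theorem exists_nhds_gauge_incl_lt {ε : ℝ} (hε : 0 < ε) :
    ∃ V ∈ 𝓝 (0 : X), ∀ y : CameronMartin μ, ‖y‖ ≤ 2 → CameronMartin.incl μ y ∈ V →
      gauge φ.hull (CameronMartin.incl μ y) < ε := by
  -- With `‖y‖ ≤ 2`, a factor of at least `4 / ε` gives a gauge of at most `ε / 2`.
  obtain ⟨V₀, hV₀, hfac⟩ := mem_comap.1 (φ.tendsto_factor (Ici_mem_atTop (4 / ε)))
  obtain ⟨V₁, ⟨hV₁, hbal⟩, hV₁₀⟩ := (nhds_basis_balanced ℝ X).mem_iff.1 hV₀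
  refine ⟨ε • V₁, (set_smul_mem_nhds_zero_iff hε.ne').2 hV₁, fun y hy2 hyV => ?_⟩
  rcases eq_or_ne y 0 with rfl | hy
  · simpa using hε
  have hpos : 0 < ‖y‖ := norm_pos_iff.2 hy
  obtain ⟨x, hx⟩ := exists_sphere_smul hy
  have hg := φ.gauge_incl_smul_le x hpos.le
  rw [← hx] at hg
  refine hg.trans_lt ?_
  rw [div_lt_iff₀ (φ.factor_pos x)]
  -- If `‖y‖ < ε`, then `1 ≤ k` suffices. Otherwise normalizing `y ∈ ε • V₁` multiplies by at most
  -- `ε⁻¹`, so the direction of `y` stays in the balanced set `V₁`.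
  rcases lt_or_ge ‖y‖ ε with hlt | hge
  · nlinarith [φ.one_le_factor x]
  · have hxV : CameronMartin.incl μ x ∈ V₁ := by
      obtain ⟨v, hv, hvy⟩ := hyV
      have : CameronMartin.incl μ x = (‖y‖⁻¹ * ε) • v := by
        rw [mul_smul]
        simp only at hvy
        rw [hvy, ← map_smul]
        congr 1
        conv_rhs => rw [hx]
        rw [norm_smul, norm_norm, mem_sphere_zero_iff_norm.1 x.2, mul_one,
          inv_smul_smul₀ hpos.ne']
      rw [this]
      refine hbal.smul_mem ?_ hv
      rw [Real.norm_of_nonneg (by positivity), inv_mul_le_iff₀ hpos, mul_one]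
      exact hge
    have h4 : 4 / ε ≤ φ.factor x := hfac (hV₁₀ hxV)
    rw [div_le_iff₀ hε] at h4
    linarith

theorem totallyBounded_range_toFun {C : Set X} (hC : IsCompact C)
    (hball : ∀ h : CameronMartin μ, ‖h‖ ≤ 1 → CameronMartin.incl μ h ∈ C) :
    TotallyBounded (Set.range fun x => CameronMartin.incl μ (φ.toFun x)) := by
  refine Metric.totallyBounded_iff.2 fun ε hε => ?_
  obtain ⟨T, hT, hTφ⟩ := φ.near_compact
  obtain ⟨t₁, ht₁, hTt⟩ := Metric.totallyBounded_iff.1 hT.totallyBounded ε hε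
  obtain ⟨V, hV, hVφ⟩ := hTφ _ (isOpen_biUnion fun _ _ => Metric.isOpen_ball) hTt
  obtain ⟨δ, hδ, hδV⟩ := Metric.mem_nhds_iff.1 hV
  obtain ⟨R, hR, hRφ⟩ := (φ.bounded_away δ hδ).exists_pos_norm_le
  -- Off the `δ`-ball the values of `φ` have `H`-norm at most `R`, so they lie in the compact set `R
  -- • C`.
  obtain ⟨t₂, ht₂, hCt⟩ := Metric.totallyBounded_iff.1 (hC.smul R).totallyBounded ε hε
  refine ⟨t₁ ∪ t₂, ht₁.union ht₂, ?_⟩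
  rw [Set.biUnion_union]
  rintro _ ⟨x, rfl⟩
  by_cases hx : CameronMartin.incl μ x ∈ Metric.ball (0 : X) δ
  · exact Or.inl (hVφ x (hδV hx))
  · refine Or.inr (hCt ⟨_, hball (R⁻¹ • φ.toFun x) ?_, ?_⟩)
    · rw [norm_smul, norm_inv, Real.norm_of_nonneg hR.le, inv_mul_le_iff₀ hR, mul_one]
      exact hRφ _ ⟨x, hx, rfl⟩
    · simp only [map_smul]
      exact smul_inv_smul₀ hR.ne' _

theorem isCompact_hull [IsUniformAddGroup X] [CompleteSpace X] {C : Set X} (hC : IsCompact C)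
    (hball : ∀ h : CameronMartin μ, ‖h‖ ≤ 1 → CameronMartin.incl μ h ∈ C) :
    IsCompact φ.hull :=
  (φ.totallyBounded_range_toFun hC hball).convexHull.closure.isCompact_of_isClosed isClosed_closure

end ShapeFunction

end Shape

end Intermediate

/-! ### The main theorem -/

theorem mainTheorem2 {X : Type*} [MetricSpace X] [AddCommGroup X] [Module ℝ X]
    [IsTopologicalAddGroup X] [ContinuousSMul ℝ X] [LocallyConvexSpace ℝ X]
    [CompleteSpace X] [TopologicalSpace.SeparableSpace X]
    (hdist : ∀ x y z : X, dist (x + z) (y + z) = dist x y)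
    [MeasurableSpace X] [BorelSpace X] (μ : Measure X) [IsGaussian μ]
    (hcentered : ∀ f : StrongDual ℝ X, ∫ x, f x ∂μ = 0)
    (φ : Intermediate.ShapeFunction μ) :
    (-φ.hull = φ.hull ∧ Convex ℝ φ.hull ∧ IsCompact φ.hull) ∧
    ∃ core : NormedSpace.Core ℝ (Intermediate.SpanOf φ.hull),
      letI := NormedAddCommGroup.ofCore core
      letI := NormedSpace.ofCore core
      CompleteSpace (Intermediate.SpanOf φ.hull) ∧
      CompleteSpace (Intermediate.generatedSpace μ φ.hull) ∧
      Intermediate.IsIntermediateSpace μ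
        ((Intermediate.SpanOf.incl φ.hull).comp
          (Intermediate.generatedSpace μ φ.hull).subtype) := by
  open Intermediate in
  have := isUniformAddGroup_of_dist_add_right hdist
  -- With completeness this makes `X` Polish, as tightness of `μ` requires.
  have : SecondCountableTopology X := UniformSpace.secondCountable_of_separable X
  obtain ⟨C, hC, hball⟩ := CameronMartin.exists_isCompact_incl_mem μ hcentered
  have hK := φ.isCompact_hull hC hball
  have hconv := φ.convex_hull
  have hneg := φ.neg_hull
  have hD : IsCompact (insert 0 φ.hull) := hK.insert 0
  let core := SpanOf.normedSpaceCore hconv hneg (hK.isVonNBounded ℝ)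
  refine ⟨⟨hneg, hconv, hK⟩, core, ?_⟩
  let := NormedAddCommGroup.ofCore core
  let := NormedSpace.ofCore core
  have hlt : ∀ (x : SpanOf φ.hull) (r : ℝ), ‖x‖ < r → SpanOf.incl _ x ∈ r • insert 0 φ.hull :=
    fun x r hx => SpanOf.mem_of_norm_lt hconv hneg hx
  have hcomplete : CompleteSpace (SpanOf φ.hull) := by
    refine completeSpace_of_isCompact_disk hD ?_ hlt fun x r hr hx =>
      SpanOf.norm_le_of_mem hr hx
    rintro x (rfl | hx)
    · exact ⟨0, map_zero _⟩
    · exact ⟨⟨x, Submodule.subset_span hx⟩, rfl⟩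
  have hcompleteE : CompleteSpace (generatedSpace μ φ.hull) :=
    (Submodule.isClosed_topologicalClosure _).completeSpace_coe
  refine ⟨hcomplete, hcompleteE,
    (SpanOf.incl_injective _).comp Subtype.val_injective, ?_, ?_⟩
  · let i₀ : CameronMartin μ →ₗ[ℝ] SpanOf φ.hull :=
      (CameronMartin.incl μ).codRestrict (Submodule.span ℝ φ.hull) φ.incl_mem_span
    have hi₀ : ∀ h, i₀ h ∈ generatedSpace μ φ.hull := fun h =>
      Submodule.le_topologicalClosure _ (Submodule.subset_span h.2)
    refine ⟨i₀.codRestrict _ hi₀, fun h => rfl, ?_⟩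
    refine isCompactOperator_of_totallyBounded_image (ι := CameronMartin.incl μ)
      (hC.totallyBounded.subset ?_) fun ε hε => φ.exists_nhds_gauge_incl_lt hε
    rintro _ ⟨h, hh, rfl⟩
    exact hball h (mem_closedBall_zero_iff.1 hh)
  · refine isCompactOperator_of_ball_mem hD fun x hx => ?_
    simpa using hlt x 1 hx
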